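/- For an integer (or real) $n$ put $$\mathcal P_n=-9(n-2)^3(n-1)^3\,(28n^3-213n^2+543n-464)\,(28n^3-45n^2+27n-6),$$ $$\mathcal Q_n=6\,(476n^6-2907n^5+7077n^4-8715n^3+5715n^2-1926n+264).$$ Then $\zeta(3)$ has the irregular continued fraction expansion $$\zeta(3)=\cfrac{9}{8+\cfrac{-184}{359+\cfrac{-30672}{\mathcal Q_3+\cfrac{\mathcal P_4}{\mathcal Q_4+\cfrac{\mathcal P_5}{\mathcal Q_5+\cdots}}}}}.$$ That is, all partial numerators are non-zero, all denominators $q_n$ ($n\ge 0$) of the continued fraction are non-zero, and its convergents $p_n/q_n$ tend to $\zeta(3)$ as $n\to\infty$. Moreover, this continued fraction is equivalent to the one produced by the recurrence relation $$\alpha_n y_{n+2}+\beta_n y_{n+1}+\gamma_n y_n=0,\qquad n=1,2,\dots,$$ at $\vartheta=2$, where $$\begin{aligned} \alpha_n&=(n+2)^3\bigl(24\vartheta^2n^3+30\vartheta^2n^2+16\vartheta^2n+3\vartheta^2+9\vartheta n^2+5\vartheta n+\vartheta-12n^3-21n^2-11n-2\bigr),\\ \beta_n&=-2\bigl(408\vartheta^2n^6+2346\vartheta^2n^5+5336\vartheta^2n^4+6130\vartheta^2n^3+3810\vartheta^2n^2+1268\vartheta^2n+172\vartheta^2\\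 &\qquad+153\vartheta n^5+769\vartheta n^4+1417\vartheta n^3+1143\vartheta n^2+382\vartheta n+52\vartheta\\ &\qquad-204n^6-1275n^5-3181n^4-4011n^3-2667n^2-886n-120\bigr),\\ \gamma_n&=n^3\bigl(24\vartheta^2n^3+102\vartheta^2n^2+148\vartheta^2n+73\vartheta^2+9\vartheta n^2+23\vartheta n+15\vartheta-12n^3-57n^2-89n-46\bigr). \end{aligned}$$ Precisely, let $a_0=0$, $a_1=8$, $a_2=359/24$, $b_1=9$, $b_2=-23/3$ and, with $\vartheta=2$, $a_n=-\beta_{n-2}/\alpha_{n-2}$, $b_n=-\gamma_{n-2}/\alpha_{n-2}$ for $n\ge 3$. Write $a_n'$ and $b_n'$ for the partial denominators and partial numerators of the expansion above, so that $a_0'=0$, $a_1'=8$, $a_2'=359$, $a_n'=\mathcal Q_n$ for $n\ge3$, and $b_1'=9$, $b_2'=-184$, $b_3'=-30672$, $b_n'=\mathcal P_n$ for $n\ge4$. Then there is a sequence of non-zero real numbers $(c_n)_{n\ge0}$ with $c_0=1$ such that $a_n'=c_na_n$ for all $n\ge0$ and $b_n'=c_nc_{n-1}b_n$ for all $n\ge1$.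 -/

import Mathlib

open Filter Topology

noncomputable section

namespace ZetaThreeCF

/-- The infinite generalized continued fraction
`a₀ + b₁ / (a₁ + b₂ / (a₂ + b₃ / (a₃ + ⋯)))`, where `b n` and `a n` are the partial numerators and
partial denominators, indexed from `n = 1` on (the value `b 0` is not used). -/
def contFrac (b a : ℕ → ℝ) : GenContFract ℝ where
  h := a 0
  s := Stream'.Seq.ofStream fun k : ℕ => ⟨b (k + 1), a (k + 1)⟩

/-- Two generalized continued fractions are equivalent if there are nonzero numbers `c₀ = 1`, `c₁`,
`c₂`, … with `aₙ' = cₙ aₙ` for `n ≥ 0` and `bₙ' = cₙ cₙ₋₁ bₙ` for `n ≥ 1`. (Entry number `n` of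
the Mathlib sequences `partNums` and `partDens` is `bₙ₊₁` and `aₙ₊₁`, respectively.) -/
def Equivalent (g g' : GenContFract ℝ) : Prop :=
  ∃ c : ℕ → ℝ, (∀ n, c n ≠ 0) ∧ c 0 = 1 ∧ g'.h = c 0 * g.h ∧
    (∀ n, g'.partDens.get? n = (g.partDens.get? n).map fun a => c (n + 1) * a) ∧
    ∀ n, g'.partNums.get? n = (g.partNums.get? n).map fun b => c (n + 1) * c n * b

/-- The polynomial `𝒫ₙ`. -/
def calP (n : ℝ) : ℝ :=
  -9 * (n - 2) ^ 3 * (n - 1) ^ 3 * (28 * n ^ 3 - 213 * n ^ 2 + 543 * n - 464) *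
    (28 * n ^ 3 - 45 * n ^ 2 + 27 * n - 6)

/-- The polynomial `𝒬ₙ`. -/
def calQ (n : ℝ) : ℝ :=
  6 * (476 * n ^ 6 - 2907 * n ^ 5 + 7077 * n ^ 4 - 8715 * n ^ 3 + 5715 * n ^ 2 - 1926 * n + 264)

/-- Partial numerators `9, -184, -30672, 𝒫₄, 𝒫₅, …` (from index `1` on; index `0` is a dummy). -/
def zetaNum : ℕ → ℝ
  | 0 => 0
  | 1 => 9
  | 2 => -184
  | 3 => -30672
  | n => calP n

/-- Head term `0` and partial denominators `8, 359, 𝒬₃, 𝒬₄, …`. -/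
def zetaDen : ℕ → ℝ
  | 0 => 0
  | 1 => 8
  | 2 => 359
  | n => calQ n

/-- The continued fraction
`9 / (8 + (-184) / (359 + (-30672) / (𝒬₃ + 𝒫₄ / (𝒬₄ + 𝒫₅ / (𝒬₅ + ⋯)))))`. -/
def zetaThreeCF : GenContFract ℝ := contFrac zetaNum zetaDen

/-- The coefficient `αₙ` of the recurrence `αₙ yₙ₊₂ + βₙ yₙ₊₁ + γₙ yₙ = 0` with parameter `t`. -/
def recAlpha (t n : ℝ) : ℝ :=
  (n + 2) ^ 3 * (24 * t ^ 2 * n ^ 3 + 30 * t ^ 2 * n ^ 2 + 16 * t ^ 2 * n + 3 * t ^ 2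
    + 9 * t * n ^ 2 + 5 * t * n + t - 12 * n ^ 3 - 21 * n ^ 2 - 11 * n - 2)

/-- The coefficient `βₙ` of the recurrence with parameter `t`. -/
def recBeta (t n : ℝ) : ℝ :=
  -2 * (408 * t ^ 2 * n ^ 6 + 2346 * t ^ 2 * n ^ 5 + 5336 * t ^ 2 * n ^ 4 + 6130 * t ^ 2 * n ^ 3
    + 3810 * t ^ 2 * n ^ 2 + 1268 * t ^ 2 * n + 172 * t ^ 2 + 153 * t * n ^ 5 + 769 * t * n ^ 4
    + 1417 * t * n ^ 3 + 1143 * t * n ^ 2 + 382 * t * n + 52 * t - 204 * n ^ 6 - 1275 * n ^ 5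
    - 3181 * n ^ 4 - 4011 * n ^ 3 - 2667 * n ^ 2 - 886 * n - 120)

/-- The coefficient `γₙ` of the recurrence with parameter `t`. -/
def recGamma (t n : ℝ) : ℝ :=
  n ^ 3 * (24 * t ^ 2 * n ^ 3 + 102 * t ^ 2 * n ^ 2 + 148 * t ^ 2 * n + 73 * t ^ 2
    + 9 * t * n ^ 2 + 23 * t * n + 15 * t - 12 * n ^ 3 - 57 * n ^ 2 - 89 * n - 46)

/-- Partial numerators `b₁ = 9`, `b₂ = -23/3`, `bₙ = -γₙ₋₂ / αₙ₋₂` for `n ≥ 3`, with parameter `2`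
(index `0` is a dummy). -/
def recNum : ℕ → ℝ
  | 0 => 0
  | 1 => 9
  | 2 => -23 / 3
  | n + 3 => -(recGamma 2 (n + 1) / recAlpha 2 (n + 1))

/-- Head term `0` and partial denominators `a₁ = 8`, `a₂ = 359/24`, `aₙ = -βₙ₋₂ / αₙ₋₂` for
`n ≥ 3`, with parameter `2`. -/
def recDen : ℕ → ℝ
  | 0 => 0
  | 1 => 8
  | 2 => 359 / 24
  | n + 3 => -(recBeta 2 (n + 1) / recAlpha 2 (n + 1))

/-- The continued fraction whose numerators and denominators solve, from index `1` on, the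
recurrence `αₙ yₙ₊₂ + βₙ yₙ₊₁ + γₙ yₙ = 0` with parameter `2`, their first values being
`p₀ = 0`, `p₁ = 9`, `p₂ = 1077/8` and `q₀ = 1`, `q₁ = 8`, `q₂ = 112`. -/
def recurrenceCF : GenContFract ℝ := contFrac recNum recDen

end ZetaThreeCF

end

/-! Apéry's sequences `aperyDen` and `aperyNum` satisfy one second-order recurrence, and their
quotient tends to ζ(3). The combination (3uₙ₊₁ + uₙ)/2 of neighbours turns any solution into a
solution of the recurrence with ϑ = 2 (`AperyRecurrence.contiguous`). Multiplied by the partial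
products of `scale`, the two combined sequences become exactly the denominators and numerators of
the continued fraction (`dens_succ`, `nums_succ`).

Everything follows from this: the denominators are non-zero because `aperyDen` is positive, the
scaling cancels in the convergents, and the combination preserves the limit. Only a crude error
bound is needed: `aperyNum n / aperyDen n` is a weighted mean of numbers that approach ζ(3)
uniformly in k. -/

namespace ZetaThreeCF

/-! ### Contiguity relations for the binomial products. -/

/-- The square root `C(n,k) C(n+k,k)` of the summand of the Apéry numbers. -/
noncomputable def aperyRoot (n k : ℕ) : ℝ := (n.choose k : ℝ) * ((n + k).choose k : ℝ)

lemma aperyRoot_zero_right (n : ℕ) : aperyRoot n 0 = 1 := by simp [aperyRoot]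

lemma aperyRoot_pos {n k : ℕ} (h : k ≤ n) : 0 < aperyRoot n k := by
  have h₁ := Nat.choose_pos h
  have h₂ : 0 < (n + k).choose k := Nat.choose_pos (by omega)
  unfold aperyRoot
  positivity

lemma aperyRoot_eq_zero {n k : ℕ} (h : n < k) : aperyRoot n k = 0 := by
  simp [aperyRoot, Nat.choose_eq_zero_of_lt h]

lemma aperyRoot_succ_right (n k : ℕ) :
    ((k : ℝ) + 1) ^ 2 * aperyRoot n (k + 1) = ((n : ℝ) - k) * (n + k + 1) * aperyRoot n k := by
  have h₁ : (n.choose (k + 1) : ℝ) * (k + 1) = n.choose k * ((n : ℝ) - k) := by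
    rcases le_or_gt k n with h | h
    · have := Nat.choose_succ_right_eq n k
      rw [← Nat.cast_sub h]
      exact_mod_cast this
    · simp [Nat.choose_eq_zero_of_lt h, Nat.choose_eq_zero_of_lt (h.trans (Nat.lt_succ_self k))]
  have h₂ : ((n + (k + 1)).choose (k + 1) : ℝ) * (k + 1) = (n + k + 1) * (n + k).choose k := by
    have := Nat.add_one_mul_choose_eq (n + k) k
    rw [← add_assoc]
    exact_mod_cast this.symm
  unfold aperyRoot
  linear_combination ((n + (k + 1)).choose (k + 1) : ℝ) * (k + 1) * h₁ +
    (n.choose k : ℝ) * ((n : ℝ) - k) * h₂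

lemma aperyRoot_succ_left (n k : ℕ) :
    ((n : ℝ) + 1 - k) * aperyRoot (n + 1) k = (n + 1 + k) * aperyRoot n k := by
  induction k with
  | zero => simp [aperyRoot_zero_right]
  | succ k ih =>
    have h₁ := aperyRoot_succ_right n k
    have h₂ := aperyRoot_succ_right (n + 1) k
    have hk : ((k : ℝ) + 1) ^ 2 ≠ 0 := by positivity
    apply mul_left_cancel₀ hk
    push_cast at h₁ h₂ ⊢
    linear_combination ((n : ℝ) - k) * h₂ - (n + k + 2) * h₁ + (n - k) * (n + k + 2) * ih

lemma aperyRoot_succ_succ (n k : ℕ) :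
    ((k : ℝ) + 1) ^ 2 * aperyRoot (n + 1) (k + 1) =
      (n + k + 1) * (n + k + 2) * aperyRoot n k := by
  have h₁ := aperyRoot_succ_left n k
  have h₂ := aperyRoot_succ_right (n + 1) k
  push_cast at h₂
  linear_combination h₂ + (n + k + 2 : ℝ) * h₁

/-- All the binomial expressions occurring in the telescoping identity at the index `(m + 1, k + 1)`
are polynomial multiples of a single quantity. -/
lemma exists_aperyRoot_eq (m k : ℕ) : ∃ u : ℝ,
    aperyRoot (m + 1) k = (k + 1) ^ 2 * u ∧
    aperyRoot (m + 1) (k + 1) = ((m : ℝ) + 1 - k) * (m + k + 2) * u ∧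
    aperyRoot (m + 2) (k + 1) = ((m : ℝ) + k + 2) * (m + k + 3) * u ∧
    aperyRoot m (k + 1) = ((m : ℝ) + 1 - k) * (m - k) * u := by
  have hk : ((k : ℝ) + 1) ^ 2 ≠ 0 := by positivity
  refine ⟨aperyRoot (m + 1) k / (k + 1) ^ 2, by field_simp, ?_, ?_, ?_⟩
  · have := aperyRoot_succ_right (m + 1) k
    push_cast at this
    field_simp
    linear_combination this
  · have := aperyRoot_succ_succ (m + 1) k
    push_cast at this
    field_simp
    linear_combination this
  · have h₁ := aperyRoot_succ_right m k
    have h₂ := aperyRoot_succ_left m k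
    field_simp
    linear_combination h₁ - (m - k : ℝ) * h₂

/-! ### Apéry's double sequence. -/

/-- Partial sums of `ζ(3)`. -/
noncomputable def cubeSum (n : ℕ) : ℝ := ∑ m ∈ Finset.range n, 1 / ((m : ℝ) + 1) ^ 3

/-- Apéry's double sequence of approximations of `ζ(3)`. -/
noncomputable def aperyApprox (n k : ℕ) : ℝ :=
  cubeSum n + ∑ m ∈ Finset.range k, (-1) ^ m / (2 * ((m : ℝ) + 1) ^ 3 * aperyRoot n (m + 1))

lemma aperyApprox_succ_right (n k : ℕ) : aperyApprox n (k + 1) =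
    aperyApprox n k + (-1) ^ k / (2 * ((k : ℝ) + 1) ^ 3 * aperyRoot n (k + 1)) := by
  simp [aperyApprox, Finset.sum_range_succ, add_assoc]

/-- The row difference has a closed form because its k-increments telescope. The bound `k ≤ n` keeps
every `aperyRoot` in a denominator non-zero. -/
lemma aperyApprox_succ_left {n k : ℕ} (h : k ≤ n) : aperyApprox (n + 1) k =
    aperyApprox n k + (-1) ^ k / (((n : ℝ) + 1) ^ 2 * (n + 1 + k) * aperyRoot n k) := by
  induction k with
  | zero =>
    simp only [aperyApprox, cubeSum, Finset.sum_range_succ, Finset.range_zero, Finset.sum_empty,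
      aperyRoot_zero_right]
    field_simp
    push_cast
    ring
  | succ k ih =>
    have ih := ih (by omega)
    rw [aperyApprox_succ_right, aperyApprox_succ_right, ih]
    have h₁ := aperyRoot_succ_right n k
    have h₂ := aperyRoot_succ_succ n k
    have p := aperyRoot_pos (show k ≤ n by omega)
    have hnk : (0 : ℝ) < n - k := by
      have : ((k + 1 : ℕ) : ℝ) ≤ n := by exact_mod_cast h
      push_cast at this
      linarith
    have e₁ : aperyRoot n (k + 1) = ((n : ℝ) - k) * (n + k + 1) * aperyRoot n k / (k + 1) ^ 2 := by
      rw [← h₁]; field_simp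
    have e₂ : aperyRoot (n + 1) (k + 1) =
        (n + k + 1) * (n + k + 2) * aperyRoot n k / (k + 1) ^ 2 := by
      rw [← h₂]; field_simp
    rw [e₁, e₂, pow_succ]
    push_cast
    have a₁ : (0 : ℝ) < n + k + 1 := by positivity
    have a₂ : (0 : ℝ) < n + k + 2 := by positivity
    have a₃ : (0 : ℝ) < n + 1 + (k + 1) := by positivity
    have a₄ : (0 : ℝ) < n + 1 + k := by positivity
    field_simp
    ring

/-- Beyond k = n the added terms are divisions by zero, hence 0. -/
lemma aperyApprox_last (n : ℕ) : aperyApprox n (n + 1) = aperyApprox n n := by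
  rw [aperyApprox_succ_right, aperyRoot_eq_zero (Nat.lt_succ_self n)]
  simp

/-- The weight vanishes for k > n, so in this form the change of row needs no bound on k. -/
lemma aperyRoot_sq_mul_aperyApprox (n k : ℕ) : aperyRoot n k ^ 2 * aperyApprox n k =
    aperyRoot n k ^ 2 * aperyApprox (n + 1) k -
      (-1) ^ k * aperyRoot n k / (((n : ℝ) + 1) ^ 2 * (n + 1 + k)) := by
  rcases le_or_gt k n with h | h
  · have p := aperyRoot_pos h
    rw [aperyApprox_succ_left h]
    have a₄ : (0 : ℝ) < n + 1 + k := by positivity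
    field_simp
    ring
  · simp [aperyRoot_eq_zero h]

/-! ### Apéry's recurrence by creative telescoping. -/

/-- Apéry's denominators. -/
noncomputable def aperyDen (n : ℕ) : ℝ := ∑ k ∈ Finset.range (n + 1), aperyRoot n k ^ 2

/-- Apéry's numerators. -/
noncomputable def aperyNum (n : ℕ) : ℝ :=
  ∑ k ∈ Finset.range (n + 1), aperyRoot n k ^ 2 * aperyApprox n k

lemma sum_aperyRoot_extend (f : ℕ → ℝ) {n N : ℕ} (h : n < N) :
    ∑ k ∈ Finset.range (n + 1), aperyRoot n k ^ 2 * f k =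
      ∑ k ∈ Finset.range N, aperyRoot n k ^ 2 * f k := by
  apply Finset.sum_subset (Finset.range_mono h)
  intro k _ hk
  rw [aperyRoot_eq_zero (by simpa using hk)]
  ring

/-- Apéry's recurrence for a sequence of real numbers. -/
def AperyRecurrence (u : ℕ → ℝ) : Prop := ∀ m : ℕ,
  ((m : ℝ) + 2) ^ 3 * u (m + 2) -
    (34 * ((m : ℝ) + 1) ^ 3 + 51 * ((m : ℝ) + 1) ^ 2 + 27 * ((m : ℝ) + 1) + 5) * u (m + 1) +
    ((m : ℝ) + 1) ^ 3 * u m = 0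

/-- The certificate for the Apéry denominators. -/
noncomputable def denCert (m k : ℕ) : ℝ :=
  4 * (2 * m + 3) * (k * (2 * k + 1) - (2 * m + 3) ^ 2) * aperyRoot (m + 1) k ^ 2

/-- The certificate for the Apéry numerators. -/
noncomputable def numCert (m k : ℕ) : ℝ :=
  denCert m k * aperyApprox (m + 1) k -
    (-1) ^ k * (5 * (2 * m + 3) * k / (((m : ℝ) + 1) * (m + 2))) * aperyRoot (m + 1) k

/-- The right side is the recurrence operator applied to the summand at k + 1. After division by u²
the claim is a polynomial identity. -/
lemma denCert_succ (m k : ℕ) : denCert m (k + 1) - denCert m k =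
    ((m : ℝ) + 2) ^ 3 * aperyRoot (m + 2) (k + 1) ^ 2 -
      (34 * ((m : ℝ) + 1) ^ 3 + 51 * ((m : ℝ) + 1) ^ 2 + 27 * ((m : ℝ) + 1) + 5) *
        aperyRoot (m + 1) (k + 1) ^ 2 +
      ((m : ℝ) + 1) ^ 3 * aperyRoot m (k + 1) ^ 2 := by
  obtain ⟨u, h₁, h₂, h₃, h₄⟩ := exists_aperyRoot_eq m k
  simp only [denCert]
  rw [h₁, h₂, h₃, h₄]
  push_cast
  ring

lemma numCert_succ (m k : ℕ) : numCert m (k + 1) - numCert m k =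
    ((m : ℝ) + 2) ^ 3 * (aperyRoot (m + 2) (k + 1) ^ 2 * aperyApprox (m + 2) (k + 1)) -
      (34 * ((m : ℝ) + 1) ^ 3 + 51 * ((m : ℝ) + 1) ^ 2 + 27 * ((m : ℝ) + 1) + 5) *
        (aperyRoot (m + 1) (k + 1) ^ 2 * aperyApprox (m + 1) (k + 1)) +
      ((m : ℝ) + 1) ^ 3 * (aperyRoot m (k + 1) ^ 2 * aperyApprox m (k + 1)) := by
  obtain ⟨u, h₁, h₂, h₃, h₄⟩ := exists_aperyRoot_eq m k
  rw [aperyRoot_sq_mul_aperyApprox m (k + 1)]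
  rcases lt_trichotomy k (m + 1) with h | h | h
  · have hc := aperyApprox_succ_right (m + 1) k
    have hd := aperyApprox_succ_left (n := m + 1) (k := k + 1) (by omega)
    have hu : 0 < u := by
      have := aperyRoot_pos (n := m + 1) (k := k) (by omega)
      rw [h₁] at this
      exact pos_of_mul_pos_right this (by positivity)
    have hmk : (0 : ℝ) < m + 1 - k := by
      have : (k : ℝ) < ((m + 1 : ℕ) : ℝ) := by exact_mod_cast h
      push_cast at this
      linarith
    simp only [numCert, denCert]
    rw [hd, eq_sub_of_add_eq hc.symm, h₁, h₂, h₃, h₄]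
    generalize aperyApprox (m + 1) (k + 1) = c
    rw [pow_succ]
    push_cast
    have a₁ : (0 : ℝ) < m + k + 2 := by positivity
    have a₂ : (0 : ℝ) < m + 1 + 1 + (k + 1) := by positivity
    have a₃ : (0 : ℝ) < m + 1 + (k + 1) := by positivity
    field_simp
    ring
  -- Boundary k = m + 1: row m + 1 is already constant here, so row m + 2 is reached by a step in k
  -- first and a change of row afterwards.
  · subst h
    have hd := aperyApprox_succ_right (m + 2) (m + 1)
    have hl := aperyApprox_succ_left (n := m + 1) (k := m + 1) le_rfl
    have hc := aperyApprox_last (m + 1)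
    have hu : 0 < u := by
      have := aperyRoot_pos (n := m + 1) (k := m + 1) (by omega)
      rw [h₁] at this
      exact pos_of_mul_pos_right this (by positivity)
    simp only [numCert, denCert]
    rw [hd, hc, hl, h₁, h₂, h₃, h₄]
    generalize aperyApprox (m + 1) (m + 1) = c
    rw [pow_succ (-1 : ℝ) (m + 1)]
    push_cast
    have a₁ : (0 : ℝ) < m + (m + 1) + 2 := by positivity
    have a₂ : (0 : ℝ) < m + (m + 1) + 3 := by positivity
    have a₃ : (0 : ℝ) < m + 1 + 1 + (m + 1) := by positivity
    have a₄ : (0 : ℝ) < m + 1 + (m + 1 + 1) := by positivity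
    field_simp
    ring
  · simp [numCert, denCert, aperyRoot_eq_zero (show m + 1 < k by omega),
      aperyRoot_eq_zero (show m + 1 < k + 1 by omega),
      aperyRoot_eq_zero (show m < k + 1 by omega),
      aperyRoot_eq_zero (show m + 2 < k + 1 by omega)]

lemma aperyRecurrence_aperyDen : AperyRecurrence aperyDen := by
  intro m
  have key : ∀ K : ℕ, ∑ k ∈ Finset.range (K + 1),
      (((m : ℝ) + 2) ^ 3 * aperyRoot (m + 2) k ^ 2 -
      (34 * ((m : ℝ) + 1) ^ 3 + 51 * ((m : ℝ) + 1) ^ 2 + 27 * ((m : ℝ) + 1) + 5) *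
        aperyRoot (m + 1) k ^ 2 +
      ((m : ℝ) + 1) ^ 3 * aperyRoot m k ^ 2) = denCert m K := by
    intro K
    induction K with
    | zero => simp [denCert, aperyRoot_zero_right]; ring
    | succ K ih => rw [Finset.sum_range_succ, ih, ← denCert_succ]; ring
  have h := key (m + 2)
  -- At K = m + 2 all three sums are complete and the certificate vanishes.
  rw [denCert, aperyRoot_eq_zero (show m + 1 < m + 2 by omega), Finset.sum_add_distrib,
    Finset.sum_sub_distrib, ← Finset.mul_sum, ← Finset.mul_sum, ← Finset.mul_sum] at h
  have e (n : ℕ) (hn : n < m + 2 + 1) :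
      aperyDen n = ∑ k ∈ Finset.range (m + 2 + 1), aperyRoot n k ^ 2 := by
    simpa [aperyDen] using sum_aperyRoot_extend (fun _ => 1) hn
  rw [e m (by omega), e (m + 1) (by omega), e (m + 2) (by omega), h]
  ring

lemma aperyRecurrence_aperyNum : AperyRecurrence aperyNum := by
  intro m
  have key : ∀ K : ℕ, ∑ k ∈ Finset.range (K + 1),
      (((m : ℝ) + 2) ^ 3 * (aperyRoot (m + 2) k ^ 2 * aperyApprox (m + 2) k) -
      (34 * ((m : ℝ) + 1) ^ 3 + 51 * ((m : ℝ) + 1) ^ 2 + 27 * ((m : ℝ) + 1) + 5) *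
        (aperyRoot (m + 1) k ^ 2 * aperyApprox (m + 1) k) +
      ((m : ℝ) + 1) ^ 3 * (aperyRoot m k ^ 2 * aperyApprox m k)) = numCert m K := by
    intro K
    induction K with
    | zero =>
      simp only [numCert, denCert, aperyRoot_zero_right, aperyApprox, cubeSum,
        Finset.sum_range_succ, Finset.range_zero, Finset.sum_empty]
      push_cast
      field_simp
      ring
    | succ K ih => rw [Finset.sum_range_succ, ih, ← numCert_succ]; ring
  have h := key (m + 2)
  rw [numCert, denCert, aperyRoot_eq_zero (show m + 1 < m + 2 by omega), Finset.sum_add_distrib,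
    Finset.sum_sub_distrib, ← Finset.mul_sum, ← Finset.mul_sum, ← Finset.mul_sum] at h
  have e (n : ℕ) (hn : n < m + 2 + 1) : aperyNum n =
      ∑ k ∈ Finset.range (m + 2 + 1), aperyRoot n k ^ 2 * aperyApprox n k :=
    sum_aperyRoot_extend _ hn
  rw [e m (by omega), e (m + 1) (by omega), e (m + 2) (by omega), h]
  ring

/-! ### Convergence of Apéry's quotients to ζ(3). -/

lemma tendsto_cubeSum : Tendsto (fun n => (cubeSum n : ℂ)) atTop (𝓝 (riemannZeta 3)) := by
  have h := zeta_eq_tsum_one_div_nat_add_one_cpow (s := 3) (by norm_num)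
  have hs : Summable fun n : ℕ => 1 / ((n : ℂ) + 1) ^ (3 : ℂ) := by
    have := (Complex.summable_one_div_nat_cpow (p := 3)).2 (by norm_num)
    simpa using (summable_nat_add_iff 1).2 this
  rw [h]
  refine hs.hasSum.tendsto_sum_nat.congr fun n => ?_
  rw [cubeSum]
  push_cast
  refine Finset.sum_congr rfl fun m _ => ?_
  norm_cast

lemma summable_one_div_succ_cube : Summable fun m : ℕ => 1 / ((m : ℝ) + 1) ^ 3 := by
  have := Real.summable_one_div_nat_pow.2 (show 1 < 3 by norm_num)
  simpa using (summable_nat_add_iff 1).2 this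

/-- The real number `ζ(3)`. -/
noncomputable def zetaThree : ℝ := ∑' m : ℕ, 1 / ((m : ℝ) + 1) ^ 3

lemma tendsto_cubeSum_real : Tendsto cubeSum atTop (𝓝 zetaThree) :=
  summable_one_div_succ_cube.hasSum.tendsto_sum_nat

lemma ofReal_zetaThree : (zetaThree : ℂ) = riemannZeta 3 :=
  tendsto_nhds_unique ((Complex.continuous_ofReal.tendsto _).comp tendsto_cubeSum_real)
    tendsto_cubeSum

lemma succ_le_choose_add (n m : ℕ) : n + 1 ≤ (n + (m + 1)).choose (m + 1) := by
  induction m with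
  | zero => simp
  | succ m ih =>
    rw [← add_assoc n (m + 1) 1, Nat.choose_succ_succ]
    omega

/-- Every non-zero correction has `aperyRoot n (m + 1)` at least n + 1, and the remaining cubes sum
to at most ζ(3). The bound is uniform in k. -/
lemma abs_aperyApprox_sub_le (n k : ℕ) : |aperyApprox n k - cubeSum n| ≤ zetaThree / (n + 1) := by
  have h : ∀ m ∈ Finset.range k,
      |(-1 : ℝ) ^ m / (2 * ((m : ℝ) + 1) ^ 3 * aperyRoot n (m + 1))| ≤
        1 / ((m : ℝ) + 1) ^ 3 / (n + 1) := by
    intro m _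
    rcases lt_or_ge n (m + 1) with hm | hm
    · rw [aperyRoot_eq_zero hm]
      simp only [mul_zero, div_zero, abs_zero]
      positivity
    · have h₁ : (1 : ℝ) ≤ n.choose (m + 1) := by exact_mod_cast Nat.choose_pos hm
      have h₂ : (n : ℝ) + 1 ≤ (n + (m + 1)).choose (m + 1) := by
        exact_mod_cast succ_le_choose_add n m
      have h₃ : (n : ℝ) + 1 ≤ aperyRoot n (m + 1) := by
        unfold aperyRoot
        nlinarith
      have hn : (0 : ℝ) < n + 1 := by positivity
      have hp : 0 < aperyRoot n (m + 1) := hn.trans_le h₃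
      rw [abs_div, abs_pow, abs_neg, abs_one, one_pow, div_div, abs_of_pos (by positivity)]
      apply one_div_le_one_div_of_le (by positivity)
      have hm3 : (0 : ℝ) < (m + 1) ^ 3 := by positivity
      nlinarith [mul_le_mul_of_nonneg_left h₃ hm3.le, mul_pos hm3 hp]
  rw [aperyApprox, add_sub_cancel_left]
  refine (Finset.abs_sum_le_sum_abs _ _).trans ((Finset.sum_le_sum h).trans ?_)
  rw [← Finset.sum_div]
  gcongr
  exact summable_one_div_succ_cube.sum_le_tsum _ fun m _ => by positivity

lemma aperyDen_pos (n : ℕ) : 0 < aperyDen n :=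
  Finset.sum_pos (fun k hk => pow_pos (aperyRoot_pos (by simpa [Nat.lt_succ_iff] using hk)) 2)
    ⟨0, by simp⟩

/-- A bound for the error of Apéry's approximations. -/
noncomputable def aperyError (n : ℕ) : ℝ := zetaThree / (n + 1) + |cubeSum n - zetaThree|

lemma abs_aperyNum_sub_le (n : ℕ) :
    |aperyNum n - zetaThree * aperyDen n| ≤ aperyError n * aperyDen n := by
  rw [aperyNum, aperyDen, Finset.mul_sum, Finset.mul_sum, ← Finset.sum_sub_distrib]
  refine (Finset.abs_sum_le_sum_abs _ _).trans (Finset.sum_le_sum fun k _ => ?_)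
  have h : |aperyApprox n k - zetaThree| ≤ aperyError n :=
    (abs_sub_le _ (cubeSum n) _).trans (by
      have := abs_aperyApprox_sub_le n k
      unfold aperyError
      linarith)
  rw [show aperyRoot n k ^ 2 * aperyApprox n k - zetaThree * aperyRoot n k ^ 2 =
    (aperyApprox n k - zetaThree) * aperyRoot n k ^ 2 by ring, abs_mul,
    abs_of_nonneg (sq_nonneg (aperyRoot n k))]
  gcongr

lemma aperyError_nonneg (n : ℕ) : 0 ≤ aperyError n := by
  have : 0 ≤ zetaThree := tsum_nonneg fun m => by positivity
  unfold aperyError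
  positivity

lemma tendsto_aperyError : Tendsto aperyError atTop (𝓝 0) := by
  have h₁ : Tendsto (fun n : ℕ => zetaThree / ((n : ℝ) + 1)) atTop (𝓝 0) := by
    have := tendsto_one_div_add_atTop_nhds_zero_nat (𝕜 := ℝ)
    simpa [div_eq_mul_inv] using this.const_mul zetaThree
  have h₂ : Tendsto (fun n => |cubeSum n - zetaThree|) atTop (𝓝 0) := by
    simpa using (tendsto_cubeSum_real.sub_const zetaThree).abs
  have h := h₁.add h₂
  rw [add_zero] at h
  exact h

/-! ### Passage to the recurrence with ϑ = 2. -/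

/-- The combination `(3 uₙ₊₁ + uₙ) / 2` of neighbouring terms. -/
noncomputable def contiguous (u : ℕ → ℝ) (n : ℕ) : ℝ := (3 * u (n + 1) + u n) / 2

lemma AperyRecurrence.contiguous {u : ℕ → ℝ} (hu : AperyRecurrence u) (n : ℕ) :
    recAlpha 2 (n + 1) * contiguous u (n + 2) + recBeta 2 (n + 1) * contiguous u (n + 1) +
      recGamma 2 (n + 1) * contiguous u n = 0 := by
  have h₁ := hu n
  have h₂ := hu (n + 1)
  push_cast at h₂
  simp only [ZetaThreeCF.contiguous, recAlpha, recBeta, recGamma]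
  generalize (n : ℝ) = x at *
  rw [show n + 1 + 2 = n + 2 + 1 from rfl, show n + 1 + 1 = n + 2 from rfl] at h₂
  -- The multipliers are forced by the coefficients of uₙ₊₃ and uₙ: the cofactors of the cubes in α
  -- and γ, times 3/2 and 1/2.
  linear_combination (3 / 2 * (24 * 2 ^ 2 * (x + 1) ^ 3 + 30 * 2 ^ 2 * (x + 1) ^ 2
    + 16 * 2 ^ 2 * (x + 1) + 3 * 2 ^ 2 + 9 * 2 * (x + 1) ^ 2 + 5 * 2 * (x + 1) + 2
    - 12 * (x + 1) ^ 3 - 21 * (x + 1) ^ 2 - 11 * (x + 1) - 2)) * h₂ +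
    (1 / 2 * (24 * 2 ^ 2 * (x + 1) ^ 3 + 102 * 2 ^ 2 * (x + 1) ^ 2 + 148 * 2 ^ 2 * (x + 1)
    + 73 * 2 ^ 2 + 9 * 2 * (x + 1) ^ 2 + 23 * 2 * (x + 1) + 15 * 2 - 12 * (x + 1) ^ 3
    - 57 * (x + 1) ^ 2 - 89 * (x + 1) - 46)) * h₁

lemma contiguous_aperyDen_pos (n : ℕ) : 0 < contiguous aperyDen n := by
  have h₁ := aperyDen_pos n
  have h₂ := aperyDen_pos (n + 1)
  unfold contiguous
  positivity

lemma tendsto_contiguous_div : Tendsto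
    (fun n => contiguous aperyNum n / contiguous aperyDen n) atTop (𝓝 zetaThree) := by
  rw [tendsto_iff_norm_sub_tendsto_zero]
  have hb : Tendsto (fun n => aperyError (n + 1) + aperyError n) atTop (𝓝 0) := by
    simpa using ((tendsto_add_atTop_iff_nat 1).2 tendsto_aperyError).add tendsto_aperyError
  refine squeeze_zero (fun n => norm_nonneg _) (fun n => ?_) hb
  have hq := contiguous_aperyDen_pos n
  have e : contiguous aperyNum n / contiguous aperyDen n - zetaThree =
      (contiguous aperyNum n - zetaThree * contiguous aperyDen n) / contiguous aperyDen n := by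
    field_simp
  rw [e, Real.norm_eq_abs, abs_div, abs_of_pos hq, div_le_iff₀ hq]
  have h₁ := abs_le.1 (abs_aperyNum_sub_le n)
  have h₂ := abs_le.1 (abs_aperyNum_sub_le (n + 1))
  have h₃ := mul_nonneg (aperyError_nonneg n) (aperyDen_pos (n + 1)).le
  have h₄ := mul_nonneg (aperyError_nonneg (n + 1)) (aperyDen_pos n).le
  unfold contiguous
  rw [abs_le]
  constructor <;> nlinarith

/-! ### The equivalence transformation. -/

/-- The factors of the equivalence transformation. -/
noncomputable def scale : ℕ → ℝ
  | 0 => 1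
  | 1 => 1
  | 2 => 24
  | n + 3 => recAlpha 2 (n + 1)

lemma recAlpha_pos (n : ℕ) : 0 < recAlpha 2 (n + 1) := by
  -- Expanded in the shifted variable, all coefficients are positive.
  have e : recAlpha 2 ((n : ℝ) + 1) =
      ((n : ℝ) + 3) ^ 3 * (84 * n ^ 3 + 369 * n ^ 2 + 549 * n + 276) := by
    unfold recAlpha; ring
  rw [e]
  positivity

lemma recGamma_pos (n : ℕ) : 0 < recGamma 2 (n + 1) := by
  have e : recGamma 2 ((n : ℝ) + 1) =
      ((n : ℝ) + 1) ^ 3 * (84 * n ^ 3 + 621 * n ^ 2 + 1539 * n + 1278) := by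
    unfold recGamma; ring
  rw [e]
  positivity

lemma scale_ne_zero (n : ℕ) : scale n ≠ 0 := by
  match n with
  | 0 => simp [scale]
  | 1 => simp [scale]
  | 2 => simp [scale]
  | n + 3 => exact (recAlpha_pos n).ne'

lemma zetaDen_eq (n : ℕ) : zetaDen n = scale n * recDen n := by
  match n with
  | 0 => simp [zetaDen, scale, recDen]
  | 1 => simp [zetaDen, scale, recDen]
  | 2 => norm_num [zetaDen, scale, recDen]
  | n + 3 =>
    have h := (recAlpha_pos n).ne'
    simp only [zetaDen, scale, recDen]
    rw [mul_neg, mul_div_cancel₀ _ h]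
    simp only [calQ, recBeta]
    push_cast
    ring

/-- For N ≥ 4 one factor α cancels, which gives 𝒫_N = -γ_{N-2} α_{N-3}. At N = 3 the preceding
factor is 24 instead, hence the exceptional -30672. -/
lemma zetaNum_eq (n : ℕ) : zetaNum (n + 1) = scale (n + 1) * scale n * recNum (n + 1) := by
  match n with
  | 0 => simp [zetaNum, scale, recNum]
  | 1 => norm_num [zetaNum, scale, recNum]
  | 2 =>
    simp only [zetaNum, scale, recNum]
    norm_num [recAlpha, recGamma]
  | n + 3 =>
    have h := (recAlpha_pos (n + 1)).ne'
    simp only [zetaNum, scale, recNum]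
    rw [mul_neg, mul_comm (recAlpha _ _), mul_assoc, mul_div_cancel₀ _ h]
    simp only [calP, recAlpha, recGamma]
    push_cast
    ring

lemma recNum_succ_ne_zero (n : ℕ) : recNum (n + 1) ≠ 0 := by
  match n with
  | 0 => simp [recNum]
  | 1 => norm_num [recNum]
  | n + 2 => exact neg_ne_zero.2 (div_pos (recGamma_pos n) (recAlpha_pos n)).ne'

lemma zetaThreeCF_s_get? (n : ℕ) :
    zetaThreeCF.s.get? n = some ⟨zetaNum (n + 1), zetaDen (n + 1)⟩ := rfl

lemma contFrac_partNums_get? (b a : ℕ → ℝ) (n : ℕ) :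
    (contFrac b a).partNums.get? n = some (b (n + 1)) := rfl

lemma contFrac_partDens_get? (b a : ℕ → ℝ) (n : ℕ) :
    (contFrac b a).partDens.get? n = some (a (n + 1)) := rfl

lemma equivalent_recurrenceCF_zetaThreeCF : Equivalent recurrenceCF zetaThreeCF := by
  refine ⟨scale, scale_ne_zero, rfl, ?_, fun n => ?_, fun n => ?_⟩
  · exact zetaDen_eq 0
  · simp only [recurrenceCF, zetaThreeCF, contFrac_partDens_get?, Option.map_some, zetaDen_eq]
  · simp only [recurrenceCF, zetaThreeCF, contFrac_partNums_get?, Option.map_some, zetaNum_eq]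

/-! ### Identification of the convergents. -/

/-- A solution of the rescaled recurrence. -/
noncomputable def scaledContiguous (u : ℕ → ℝ) (n : ℕ) : ℝ :=
  (∏ i ∈ Finset.range (n + 2), scale i) * contiguous u n

lemma AperyRecurrence.scaledContiguous {u : ℕ → ℝ} (hu : AperyRecurrence u) (n : ℕ) :
    scaledContiguous u (n + 2) = zetaDen (n + 3) * scaledContiguous u (n + 1) +
      zetaNum (n + 3) * scaledContiguous u n := by
  have h := hu.contiguous n
  have hα := (recAlpha_pos n).ne'
  rw [zetaDen_eq, zetaNum_eq]
  simp only [ZetaThreeCF.scaledContiguous, Finset.prod_range_succ _ (n + 3),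
    Finset.prod_range_succ _ (n + 2)]
  simp only [show scale (n + 3) = recAlpha 2 (n + 1) from rfl,
    show recDen (n + 3) = -(recBeta 2 (n + 1) / recAlpha 2 (n + 1)) from rfl,
    show recNum (n + 2 + 1) = -(recGamma 2 (n + 1) / recAlpha 2 (n + 1)) from rfl]
  field_simp
  linear_combination (∏ i ∈ Finset.range (n + 2), scale i) * scale (n + 2) * h

lemma aperyDen_values : aperyDen 0 = 1 ∧ aperyDen 1 = 5 ∧ aperyDen 2 = 73 := by
  refine ⟨?_, ?_, ?_⟩ <;>
  norm_num [aperyDen, Finset.sum_range_succ, aperyRoot, Nat.choose]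

lemma aperyNum_values : aperyNum 0 = 0 ∧ aperyNum 1 = 6 ∧ aperyNum 2 = 351 / 4 := by
  refine ⟨?_, ?_, ?_⟩ <;>
  norm_num [aperyNum, aperyApprox, cubeSum, Finset.sum_range_succ, aperyRoot, Nat.choose]

/-- Both sides obey the same recurrence, so two initial values suffice. The shift arises because q₀
= 1 lies outside the recurrence and q₁ = 8 = (3·5 + 1)/2 is its first term. -/
lemma dens_succ (n : ℕ) : zetaThreeCF.dens (n + 1) = scaledContiguous aperyDen n := by
  obtain ⟨h₀, h₁, h₂⟩ := aperyDen_values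
  have d₁ : zetaThreeCF.dens 1 = scaledContiguous aperyDen 0 := by
    rw [GenContFract.first_den_eq (zetaThreeCF_s_get? 0)]
    norm_num [scaledContiguous, contiguous, h₀, h₁, scale, Finset.prod_range_succ, zetaDen]
  induction n using Nat.twoStepInduction with
  | zero => exact d₁
  | one =>
    refine (GenContFract.dens_recurrence (zetaThreeCF_s_get? 1) GenContFract.zeroth_den_eq_one d₁).trans ?_
    norm_num [scaledContiguous, contiguous, h₀, h₁, h₂, scale, Finset.prod_range_succ, zetaDen,
      zetaNum]
  | more n ih₁ ih₂ =>
    exact (GenContFract.dens_recurrence (zetaThreeCF_s_get? (n + 2)) ih₁ ih₂).trans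
      (aperyRecurrence_aperyDen.scaledContiguous n).symm

lemma nums_succ (n : ℕ) : zetaThreeCF.nums (n + 1) = scaledContiguous aperyNum n := by
  obtain ⟨h₀, h₁, h₂⟩ := aperyNum_values
  have d₁ : zetaThreeCF.nums 1 = scaledContiguous aperyNum 0 := by
    rw [GenContFract.first_num_eq (zetaThreeCF_s_get? 0)]
    norm_num [scaledContiguous, contiguous, h₀, h₁, scale, Finset.prod_range_succ, zetaDen,
      zetaNum, zetaThreeCF, contFrac]
  induction n using Nat.twoStepInduction with
  | zero => exact d₁
  | one =>
    refine (GenContFract.nums_recurrence (zetaThreeCF_s_get? 1) GenContFract.zeroth_num_eq_h d₁).trans ?_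
    norm_num [scaledContiguous, contiguous, h₀, h₁, h₂, scale, Finset.prod_range_succ, zetaDen,
      zetaNum, zetaThreeCF, contFrac]
  | more n ih₁ ih₂ =>
    exact (GenContFract.nums_recurrence (zetaThreeCF_s_get? (n + 2)) ih₁ ih₂).trans
      (aperyRecurrence_aperyNum.scaledContiguous n).symm

lemma dens_ne_zero (n : ℕ) : zetaThreeCF.dens n ≠ 0 := by
  cases n with
  | zero => rw [GenContFract.zeroth_den_eq_one]; exact one_ne_zero
  | succ n =>
    rw [dens_succ]
    exact mul_ne_zero (Finset.prod_ne_zero_iff.2 fun i _ => scale_ne_zero i)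
      (contiguous_aperyDen_pos n).ne'

lemma tendsto_convs : Tendsto (fun n => zetaThreeCF.convs n) atTop (𝓝 zetaThree) := by
  rw [← tendsto_add_atTop_iff_nat 1]
  refine tendsto_contiguous_div.congr fun n => ?_
  rw [GenContFract.conv_eq_num_div_den, dens_succ, nums_succ, scaledContiguous, scaledContiguous,
    mul_div_mul_left _ _ (Finset.prod_ne_zero_iff.2 fun i _ => scale_ne_zero i)]

end ZetaThreeCF

theorem mainTheorem4 :
    (∀ (n : ℕ) (b : ℝ), ZetaThreeCF.zetaThreeCF.partNums.get? n = some b → b ≠ 0) ∧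
    (∀ n : ℕ, ZetaThreeCF.zetaThreeCF.dens n ≠ 0) ∧
    Tendsto (fun n : ℕ => ((ZetaThreeCF.zetaThreeCF.convs n : ℝ) : ℂ)) atTop
      (𝓝 (riemannZeta 3)) ∧
    ZetaThreeCF.Equivalent ZetaThreeCF.recurrenceCF ZetaThreeCF.zetaThreeCF := by
  refine ⟨fun n b h => ?_, ZetaThreeCF.dens_ne_zero, ?_,
    ZetaThreeCF.equivalent_recurrenceCF_zetaThreeCF⟩
  · obtain rfl := Option.some.inj h
    change ZetaThreeCF.zetaNum (n + 1) ≠ 0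
    rw [ZetaThreeCF.zetaNum_eq]
    exact mul_ne_zero (mul_ne_zero (ZetaThreeCF.scale_ne_zero _) (ZetaThreeCF.scale_ne_zero _))
      (ZetaThreeCF.recNum_succ_ne_zero n)
  · rw [← ZetaThreeCF.ofReal_zetaThree]
    exact (Complex.continuous_ofReal.tendsto _).comp ZetaThreeCF.tendsto_convs
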